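/- Work in the Euclidean plane $\mathbb{R}^2$. For $X\subseteq\mathbb{R}^2$ and $s>0$ let $\mathrm{offset}(X,s)=X\oplus D_s=\{x+v : x\in X,\ \|v\|\le s\}$, where $D_s$ is the closed disk of radius $s$ centered at the origin, and let $\mathrm{inset}(X,s)=\mathbb{R}^2\setminus\mathrm{offset}(\mathbb{R}^2\setminus X,s)$, that is, the set of all $x$ such that the closed disk of radius $s$ around $x$ is contained in $X$. A *polygonal region* is a closed set $X\subseteq\mathbb{R}^2$ whose boundary is the union of finitely many (possibly degenerate) line segments with pairwise disjoint relative interiors; it need not be connected, and it may have empty interior (for instance, it may be a single point or a segment). Let $Q$ be a bounded polygonal region, and let $r>0$ and $\varepsilon>0$. Algorithm $\mathrm{Decide}(Q,r,\varepsilon)$ computes $Q_\varepsilon=\mathrm{offset}(Q,\varepsilon)$, then $\Pi=\mathrm{inset}(Q_\varepsilon,r)$, then $Q'=\mathrm{offset}(\Pi,r+\varepsilon)$; it returns YES if $Q\subseteq Q'$, and NO otherwise. Then $\mathrm{Decide}(Q,r,\varepsilon)$ returns YES if and only if there exists a polygonal region $P$ such that the (symmetric) Hausdorff distance of $\mathrm{offset}(P,r)$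 and $Q$ is at most $\varepsilon$. (The Hausdorff distance of the empty set to a nonempty set is taken to be $\infty$, and that of the empty set to itself to be $0$.) -/

import Mathlib

open scoped Pointwise

/-- The Euclidean plane. -/
abbrev Plane : Type := EuclideanSpace ℝ (Fin 2)

/-- A polygonal region: a closed set of the plane whose boundary is the union of finitely many
line segments with pairwise disjoint (relative) interiors. A pair `(a, b)` in `S` stands for the
segment from `a` to `b`; a single point counts as a degenerate segment (which is its own relative
interior), so that finite sets of points and polygonal arcs are (degenerate) polygonal regions. -/
def IsPolygonalRegion (X : Set Plane) : Prop :=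
  IsClosed X ∧ ∃ S : Finset (Plane × Plane),
    frontier X = ⋃ e ∈ S, segment ℝ e.1 e.2 ∧
    (S : Set (Plane × Plane)).PairwiseDisjoint (fun e => openSegment ℝ e.1 e.2)

/-- The `r`-offset of `X`: the Minkowski sum of `X` and the closed disk of radius `r` centered at
the origin. -/
def offset (X : Set Plane) (r : ℝ) : Set Plane :=
  X + Metric.closedBall (0 : Plane) r

/-- The `r`-inset of `X`: the complement of the `r`-offset of the complement of `X`. -/
def inset (X : Set Plane) (r : ℝ) : Set Plane :=
  (offset Xᶜ r)ᶜ

/-- The `r`-inset of `X` consists of the centers of the closed `r`-disks contained in `X`. -/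
theorem inset_eq (X : Set Plane) (r : ℝ) :
    inset X r = {x | Metric.closedBall x r ⊆ X} := by
  ext x
  simp only [inset, offset, Set.mem_compl_iff, Set.mem_add, Set.mem_ofPred_eq, Set.subset_def]
  constructor
  · intro h y hy
    by_contra hyX
    refine h ⟨y, hyX, x - y, ?_, by abel⟩
    rw [Metric.mem_closedBall, dist_comm, dist_eq_norm] at hy
    simpa using hy
  · rintro h ⟨y, hyX, v, hv, rfl⟩
    exact hyX (h y (by simpa [dist_eq_norm] using hv))

/-- `X` is `ε`-close to `Y` if their (symmetric) Hausdorff distance is at most `ε`. The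
extended-real-valued distance is used, so that the empty set is at infinite distance from every
nonempty set. -/
def IsClose (ε : ℝ) (X Y : Set Plane) : Prop :=
  Metric.hausdorffEDist X Y ≤ ENNReal.ofReal ε

/-- The two possible answers of the decision algorithm. -/
inductive Answer : Type
  | YES
  | NO

open Classical in
/-- The decision algorithm: `ε`-offset, then `r`-inset, then `(r + ε)`-offset, then the
inclusion test. -/
noncomputable def Decide (Q : Set Plane) (r ε : ℝ) : Answer :=
  let Qε := offset Q ε
  let Pi' := inset Qε r
  let Q' := offset Pi' (r + ε)
  if Q ⊆ Q' then Answer.YES else Answer.NO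

open Filter Topology Metric

/-! If `P` is `ε`-close, then `P` lies in the inset `Π` and the inclusion test succeeds. Conversely,
`Π` itself need not be polygonal, so a finite subset `F` with `Q ⊆ offset F (r + ε)` serves as `P`.

Such an `F` exists by compactness, once each `q ∈ Q` has a neighbourhood in `Q` covered by finitely
many disks (`exists_finite_subset_offset`). Only a `q` at distance exactly `r + ε` from `Π` is hard.
There `Q` is a cone, and compactness of its directions leaves one task: for each direction, find a
nearest center whose disk covers an initial stretch of the ray (`exists_center_inner_neg`). If there
were none, the centers covering the ray would tend to a center `p` with `q - p` perpendicular to it.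
Points of a parabola at `p` are too close to `q` to lie in `Π`, so each has a blocking point outside
`offset Q ε`; `false_of_blocked` rules out every limit of these. -/

theorem mem_offset {X : Set Plane} {s : ℝ} {x : Plane} :
    x ∈ offset X s ↔ ∃ y ∈ X, ‖x - y‖ ≤ s := by
  simp only [offset, Set.mem_add, mem_closedBall_zero_iff]
  constructor
  · rintro ⟨y, hy, v, hv, rfl⟩
    exact ⟨y, hy, by simpa using hv⟩
  · rintro ⟨y, hy, h⟩
    exact ⟨y, hy, x - y, h, by abel⟩

theorem mem_inset {X : Set Plane} {s : ℝ} {x : Plane} :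
    x ∈ inset X s ↔ ∀ c ∉ X, s < ‖c - x‖ := by
  rw [inset_eq]
  simp only [Set.mem_ofPred_eq, Set.subset_def, mem_closedBall, dist_eq_norm]
  refine forall_congr' fun c => ?_
  rw [← not_imp_not, not_le]

/-! ### Local conical structure of polygonal regions and their offsets -/

/-- `X` coincides with a cone of apex `k` inside the ball of radius `ρ` around `k`. -/
def IsConeWithin (X : Set Plane) (k : Plane) (ρ : ℝ) : Prop :=
  ∀ v : Plane, ‖v‖ < ρ → k + v ∈ X → ∀ t : ℝ, 0 < t → ‖t • v‖ < ρ → k + t • v ∈ X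

/-- The "eventually" form lets finitely many segments share one radius. -/
theorem eventually_isConeWithin_segment (a b k : Plane) :
    ∀ᶠ ρ in 𝓝[>] (0 : ℝ), IsConeWithin (segment ℝ a b) k ρ := by
  have small : ∀ c : ℝ, ∀ᶠ ρ in 𝓝[>] (0 : ℝ), 0 < c → ρ < c := by
    intro c
    by_cases hc : 0 < c
    · filter_upwards [nhdsWithin_le_nhds (Iio_mem_nhds hc)] with ρ hρ _ using hρ
    · exact Eventually.of_forall fun _ h => absurd h hc
  by_cases hk : k ∈ segment ℝ a b
  · rw [segment_eq_image'] at hk ⊢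
    obtain ⟨κ, ⟨hκ0, hκ1⟩, rfl⟩ := hk
    filter_upwards [small (κ * ‖b - a‖), small ((1 - κ) * ‖b - a‖)] with ρ h0 h1 v _ hv t ht htv
    obtain ⟨θ, ⟨hθ0, hθ1⟩, hθ⟩ := hv
    have hvd : v = (θ - κ) • (b - a) := by
      rw [sub_smul, eq_sub_iff_add_eq]
      simp only [add_assoc, add_right_inj] at hθ
      rw [hθ, add_comm]
    rcases eq_or_ne b a with rfl | hba
    · exact ⟨κ, ⟨hκ0, hκ1⟩, by simp [hvd]⟩
    have hd : 0 < ‖b - a‖ := norm_pos_iff.2 (sub_ne_zero.2 hba)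
    rw [hvd, smul_smul, norm_smul, Real.norm_eq_abs] at htv
    refine ⟨κ + t * (θ - κ), ⟨?_, ?_⟩, by simp only [hvd]; module⟩
    · rcases hκ0.eq_or_lt with h | h
      · rw [← h]; have := mul_nonneg ht.le hθ0; simpa using this
      · have := lt_of_mul_lt_mul_right (htv.trans (h0 (mul_pos h hd))) hd.le
        linarith [neg_abs_le (t * (θ - κ))]
    · rcases hκ1.eq_or_lt with h | h
      · rw [h]; nlinarith
      · have := lt_of_mul_lt_mul_right (htv.trans (h1 (mul_pos (sub_pos.2 h) hd))) hd.le
        linarith [le_abs_self (t * (θ - κ))]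
  · have hc : IsClosed (segment ℝ a b) := by
      rw [segment_eq_image']
      exact (isCompact_Icc.image (by fun_prop)).isClosed
    obtain ⟨δ, hδ, hball⟩ := Metric.isOpen_iff.1 hc.isOpen_compl k hk
    filter_upwards [small δ] with ρ hρ v hv hkv
    exact absurd hkv (hball (by simpa using hv.trans (hρ hδ)))

/-- A polygonal region is a cone near each of its points. -/
theorem IsPolygonalRegion.exists_isConeWithin {X : Set Plane} (hX : IsPolygonalRegion X)
    {k : Plane} : ∃ ρ > 0, IsConeWithin X k ρ := by
  obtain ⟨hcl, S, hS, -⟩ := hX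
  have hev := (eventually_all_finset S).2 fun e _ => eventually_isConeWithin_segment e.1 e.2 k
  obtain ⟨ρ, hρ, hρ0⟩ := (hev.and self_mem_nhdsWithin).exists
  refine ⟨ρ, hρ0, fun v hv hkv t ht htv => ?_⟩
  by_contra hnot
  -- The path along the ray from `k + v` to `k + t • v` leaves `X`, so it meets a boundary segment;
  -- conicity of that segment puts `k + t • v` on the frontier.
  let I : Set Plane := (fun s : ℝ => k + s • v) '' Set.uIcc 1 t
  have hI : IsPreconnected I := isPreconnected_uIcc.image _ (by fun_prop)
  have h1 : (I ∩ X).Nonempty := ⟨_, ⟨1, Set.left_mem_uIcc, rfl⟩, by simpa using hkv⟩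
  have h2 : (I ∩ Xᶜ).Nonempty := ⟨_, ⟨t, Set.right_mem_uIcc, rfl⟩, hnot⟩
  have h3 : (I ∩ frontier X).Nonempty := by
    by_contra hne
    rw [Set.not_nonempty_iff_eq_empty, ← Set.disjoint_iff_inter_eq_empty] at hne
    obtain ⟨y, hyI, hyX⟩ := h1
    obtain ⟨z, hzI, hzX⟩ := h2
    have hsub : I ⊆ interior X ∪ Xᶜ := by
      intro w hw
      by_cases hwX : w ∈ X
      · left
        by_contra hwi
        exact Set.disjoint_left.1 hne hw ⟨subset_closure hwX, hwi⟩
      · exact Or.inr hwX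
    have hyi : y ∈ interior X := (hsub hyI).resolve_right (fun h => h hyX)
    obtain ⟨w, -, hw1, hw2⟩ := hI _ _ isOpen_interior hcl.isOpen_compl hsub
      ⟨y, hyI, hyi⟩ ⟨z, hzI, hzX⟩
    exact hw2 (interior_subset hw1)
  obtain ⟨_, ⟨μ, hμ, rfl⟩, hμX⟩ := h3
  have hμ0 : 0 < μ := lt_of_lt_of_le (lt_min one_pos ht) hμ.1
  have hμv : ‖μ • v‖ < ρ := by
    rw [norm_smul, Real.norm_of_nonneg hμ0.le]
    rw [norm_smul, Real.norm_of_nonneg ht.le] at htv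
    rcases le_max_iff.1 hμ.2 with h | h
    · exact lt_of_le_of_lt (by nlinarith [norm_nonneg v]) hv
    · exact lt_of_le_of_lt (by gcongr) htv
  rw [hS] at hμX
  simp only [Set.mem_iUnion] at hμX
  obtain ⟨e, he, hmem⟩ := hμX
  have hmul : (t / μ) • μ • v = t • v := by rw [smul_smul, div_mul_cancel₀ _ hμ0.ne']
  have := hρ e he (μ • v) hμv hmem (t / μ) (div_pos ht hμ0) (by rwa [hmul])
  rw [hmul] at this
  refine hnot (hcl.frontier_subset ?_)
  rw [hS]
  exact Set.mem_biUnion he this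

/-- The offset of a compact set which is a cone near each of its points is star-shaped near each
point of the plane, in the sense that its complement is closed under small dilations. -/
theorem exists_dilation_notMem_offset {X : Set Plane} (hX : IsCompact X)
    (hcone : ∀ k ∈ X, ∃ ρ > 0, IsConeWithin X k ρ) (ε : ℝ) (o : Plane) :
    ∃ σ > 0, ∀ v : Plane, ‖v‖ < σ → ∀ t : ℝ, 0 < t → t ≤ 1 →
      o + t • v ∉ offset X ε → o + v ∉ offset X ε := by
  choose! ρ hρ0 hρ using hcone
  -- The part of `X` outside `G` is compact and farther than `ε` from `o`, so it cannot affect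
  -- points near `o`.
  let G : Set Plane := ⋃ k ∈ X ∩ closedBall o ε, ball k (ρ k)
  have hG : IsOpen G := isOpen_biUnion fun _ _ => isOpen_ball
  have hK : IsCompact (X \ G) := hX.diff hG
  have hfar : ∃ σ > 0, ∀ y ∈ X \ G, ε + σ ≤ ‖y - o‖ := by
    rcases (X \ G).eq_empty_or_nonempty with h | h
    · exact ⟨1, one_pos, by simp [h]⟩
    obtain ⟨z, hz, hmin⟩ := hK.exists_isMinOn h (f := fun y => ‖y - o‖) (by fun_prop)
    have hlt : ε < ‖z - o‖ := by
      by_contra! hle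
      have hzK : z ∈ X ∩ closedBall o ε := ⟨hz.1, by rwa [mem_closedBall, dist_eq_norm]⟩
      exact hz.2 (Set.mem_biUnion hzK (mem_ball_self (hρ0 z hz.1)))
    exact ⟨‖z - o‖ - ε, by linarith, fun y hy => by have := hmin hy; simp at this; linarith⟩
  obtain ⟨σ, hσ, hfar⟩ := hfar
  refine ⟨σ, hσ, fun v hv t ht ht1 hnot hmem => hnot ?_⟩
  obtain ⟨y, hy, hyd⟩ := mem_offset.1 hmem
  have hyG : y ∈ G := by
    by_contra hyG
    have h1 := hfar y ⟨hy, hyG⟩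
    have h2 : ‖y - o‖ ≤ ‖o + v - y‖ + ‖v‖ := by
      calc ‖y - o‖ = ‖v - (o + v - y)‖ := by congr 1; abel
        _ ≤ _ := by exact (norm_sub_le _ _).trans_eq (add_comm _ _)
    linarith
  simp only [G, Set.mem_iUnion] at hyG
  obtain ⟨k, ⟨hkX, hko⟩, hky⟩ := hyG
  rw [mem_closedBall, dist_comm, dist_eq_norm] at hko
  rw [mem_ball, dist_eq_norm] at hky
  -- Contract the witness `y` towards `k` while `o + v` contracts towards `o`; the new difference is
  -- a convex combination of two vectors of norm at most `ε`.
  refine mem_offset.2 ⟨k + t • (y - k), hρ k hkX (y - k) hky (by simpa) t ht ?_, ?_⟩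
  · rw [norm_smul, Real.norm_of_nonneg ht.le]
    nlinarith [norm_nonneg (y - k)]
  · have : o + t • v - (k + t • (y - k)) = (1 - t) • (o - k) + t • (o + v - y) := by module
    rw [this]
    refine (norm_add_le _ _).trans ?_
    rw [norm_smul, norm_smul, Real.norm_of_nonneg ht.le, Real.norm_of_nonneg (by linarith)]
    nlinarith

/-! ### Excluding the blocking points in coordinates -/

/-- A point `(x, x² / (2r))` slightly above the disk-packing position `(x, h)` cannot be blocked by
obstacles `C` which avoid the `r`-disks around the origin and around the points `(x, h)`, the
`ε`-disks around the points `(s, r + ε)`, and are closed under dilations at `(0, r)`. -/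
theorem false_of_blocked {ι : Type*} {l : Filter ι} [l.NeBot] {C : ℝ → ℝ → Prop}
    {r ε ρ σ A B : ℝ} (hr : 0 < r) (hε : 0 < ε) (hρ : 0 < ρ) (hσ : 0 < σ) {x h a b : ι → ℝ}
    (hx : Tendsto x l (𝓝 0)) (hh : Tendsto h l (𝓝 0)) (ha : Tendsto a l (𝓝 A))
    (hb : Tendsto b l (𝓝 B)) (hx0 : ∀ᶠ i in l, 0 < x i) (hh0 : ∀ᶠ i in l, 0 ≤ h i)
    (hhx : ∀ᶠ i in l, h i ≤ x i ^ 2 / (2 * r)) (hC : ∀ᶠ i in l, C (a i) (b i))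
    (hC0 : ∀ a b, C a b → r ^ 2 < a ^ 2 + b ^ 2)
    (hCx : ∀ᶠ i in l, ∀ a b, C a b → r ^ 2 < (a - x i) ^ 2 + (b - h i) ^ 2)
    (hCs : ∀ a b, C a b → ∀ s, 0 ≤ s → s < ρ → ε ^ 2 < (a - s) ^ 2 + (b - (r + ε)) ^ 2)
    (hstar : ∀ a b t : ℝ, 0 < t → t ≤ 1 → a ^ 2 + b ^ 2 < σ ^ 2 → C (t * a) (r + t * b) →
      C a (r + b))
    (hnear : ∀ᶠ i in l, (a i - x i) ^ 2 + (b i - x i ^ 2 / (2 * r)) ^ 2 ≤ r ^ 2) : False := by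
  have hx2 : Tendsto (fun i => x i ^ 2 / (2 * r)) l (𝓝 0) := by
    simpa using (hx.pow 2).div_const (2 * r)
  have hcirc : A ^ 2 + B ^ 2 = r ^ 2 := by
    apply le_antisymm
    · have := ((ha.sub hx).pow 2).add ((hb.sub hx2).pow 2)
      simpa using le_of_tendsto this hnear
    · exact ge_of_tendsto ((ha.pow 2).add (hb.pow 2)) (hC.mono fun i hi => (hC0 _ _ hi).le)
  -- no obstacle accumulates to the right of the origin
  have hA : A ≤ 0 := by
    have key : ∀ᶠ j in l, 2 * A ≤ x j + |B| * x j / r + x j ^ 3 / (4 * r ^ 2) := by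
      filter_upwards [hCx, hx0, hh0, hhx] with j hj hxj hhj hhxj
      have h1 : r ^ 2 ≤ (A - x j) ^ 2 + (B - h j) ^ 2 :=
        ge_of_tendsto (((ha.sub_const _).pow 2).add ((hb.sub_const _).pow 2))
          (hC.mono fun i hi => (hj _ _ hi).le)
      have h2 : 2 * x j * A ≤ x j ^ 2 + 2 * |B| * h j + h j ^ 2 := by
        nlinarith [neg_abs_le B]
      have h3 : 2 * x j * A ≤ x j ^ 2 + 2 * |B| * (x j ^ 2 / (2 * r))
          + (x j ^ 2 / (2 * r)) ^ 2 := h2.trans (by gcongr)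
      have h4 : x j * (2 * A) ≤ x j * (x j + |B| * x j / r + x j ^ 3 / (4 * r ^ 2)) := by
        refine le_trans (by linarith) (h3.trans (le_of_eq ?_))
        field_simp
        ring
      exact le_of_mul_le_mul_left h4 hxj
    have hlim : Tendsto (fun j => x j + |B| * x j / r + x j ^ 3 / (4 * r ^ 2)) l (𝓝 0) := by
      simpa using (hx.add ((hx.const_mul |B|).div_const r)).add
        ((hx.pow 3).div_const (4 * r ^ 2))
    linarith [ge_of_tendsto hlim key]
  rcases hA.lt_or_eq with hA | hA
  -- A limit strictly to the left: moving the disk to the right takes it away from the obstacle.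
  · have hlim : Tendsto (fun i => 2 * a i + x i / r * b i) l (𝓝 (2 * A)) := by
      simpa using (ha.const_mul 2).add ((hx.div_const r).mul hb)
    obtain ⟨i, hi, hCi, hxi, hni⟩ := ((hlim.eventually_lt_const (show 2 * A < 0 by linarith)).and
      (hC.and (hx0.and hnear))).exists
    have h0 := hC0 _ _ hCi
    have h1 : (a i - x i) ^ 2 + (b i - x i ^ 2 / (2 * r)) ^ 2 = a i ^ 2 + b i ^ 2
        - x i * (2 * a i + x i / r * b i) + x i ^ 2 + (x i ^ 2 / (2 * r)) ^ 2 := by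
      field_simp
      ring
    nlinarith [mul_neg_of_pos_of_neg hxi hi, sq_nonneg (x i), sq_nonneg (x i ^ 2 / (2 * r))]
  subst hA
  have hB : B = r ∨ B = -r := sq_eq_sq_iff_eq_or_eq_neg.1 (by linarith)
  rcases hB with rfl | rfl
  · have evb : ∀ᶠ i in l, |b i - B| < min ε B := by
      have : Tendsto (fun i => |b i - B|) l (𝓝 0) := by simpa using (hb.sub_const B).abs
      exact this.eventually_lt_const (lt_min hε hr)
    have evx : ∀ᶠ i in l, x i < B := hx.eventually_lt_const hr
    have eva : ∀ᶠ i in l, -ε < a i := ha.eventually_const_lt (by linarith)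
    have eva' : ∀ᶠ i in l, a i < ρ := ha.eventually_lt_const hρ
    -- If `a i ≤ 0`, the `ε`-disk above gives `β ≤ a² / ε ≤ -a`, too low for the obstacle to block
    -- the parabola point.
    have hright : ∀ᶠ i in l, 0 < a i := by
      filter_upwards [evb, evx, eva, hC, hx0, hnear] with i hbi hxB hai hCi hxi hni
      by_contra! hneg
      obtain ⟨hbε, -⟩ := lt_min_iff.1 hbi
      have h0 := hC0 _ _ hCi
      have h1 := hCs _ _ hCi 0 le_rfl hρ
      obtain ⟨β, hβ⟩ : ∃ β, b i = B + β := ⟨b i - B, by ring⟩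
      rw [hβ] at h0 h1 hni hbε
      simp only [add_sub_cancel_left] at hbε
      have h2 : (a i - x i) ^ 2 + (B + β - x i ^ 2 / (2 * B)) ^ 2 = a i ^ 2 + (B + β) ^ 2
          + x i * (2 * (-a i) - x i * β / B) + (x i ^ 2 / (2 * B)) ^ 2 := by
        field_simp
        ring
      have h3 : 0 ≤ 2 * (-a i) - x i * β / B := by
        rcases le_total β 0 with hβ0 | hβ0
        · have : x i * β / B ≤ 0 :=
            div_nonpos_of_nonpos_of_nonneg (mul_nonpos_of_nonneg_of_nonpos hxi.le hβ0) hr.le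
          linarith
        · rw [abs_of_nonneg hβ0] at hbε
          have h4 : β * ε ≤ a i ^ 2 := by nlinarith
          have h5 : β ≤ -a i := by nlinarith
          have h6 : x i * β / B ≤ β := by
            rw [div_le_iff₀ hr]; nlinarith
          linarith
      nlinarith [mul_nonneg hxi.le h3, sq_nonneg (x i ^ 2 / (2 * B))]
    have hslope : ∀ᶠ i in l, b i - B < 0 ∧ -(b i - B) * B ≤ a i ^ 2 := by
      filter_upwards [evb, hright, eva', hC] with i hbi hai haρ hCi
      obtain ⟨hbε, hbB⟩ := lt_min_iff.1 hbi
      have h0 := hC0 _ _ hCi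
      have h1 := hCs _ _ hCi (a i) hai.le haρ
      obtain ⟨h2, h3⟩ := abs_lt.1 hbε
      obtain ⟨h4, h5⟩ := abs_lt.1 hbB
      have h6 : b i - B < 0 := by
        by_contra! h7
        nlinarith
      exact ⟨h6, by nlinarith⟩
    -- Fix `j`, then take `i` much later: dilating obstacle `i` at `(0, r)` to abscissa `x j` gives
    -- an obstacle just below height `r`, inside the disk around `(x j, h j)`.
    obtain ⟨j, hxj, hxσ, hCj, hhj, hhr⟩ := (hx0.and ((hx.eventually_lt_const
      (show 0 < σ / 2 by linarith)).and (hCx.and (hh0.and (hh.eventually_lt_const hr))))).exists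
    have hlima : Tendsto (fun i => x j * a i) l (𝓝 0) := by simpa using ha.const_mul (x j)
    obtain ⟨i, hai, ⟨hbi, hsl⟩, haj, hsm1, hsm2, hCi⟩ := (hright.and (hslope.and
      ((ha.eventually_lt_const hxj).and ((hlima.eventually_lt_const
        (show 0 < B * (σ / 2) by positivity)).and ((hlima.eventually_lt_const
        (show 0 < B * B by positivity)).and hC))))).exists
    set β := b i - B with hβ
    set y := x j / a i * β with hy
    have hy0 : y < 0 := mul_neg_of_pos_of_neg (by positivity) hbi
    have hyB : -y * B ≤ x j * a i := by
      have : -y * B = x j / a i * (-β * B) := by rw [hy]; ring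
      rw [this, show x j * a i = x j / a i * a i ^ 2 by field_simp]
      gcongr
    have hyσ : -y < σ / 2 := by nlinarith
    have hyB' : -y < B := by nlinarith
    have hmem := hstar (x j) y (a i / x j) (by positivity) ((div_le_one hxj).2 haj.le)
      (by nlinarith) (by
        convert hCi using 1
        · field_simp
        · rw [hy]; field_simp; rw [hβ]; ring)
    have := hCj _ _ hmem
    nlinarith
  -- A limit at the bottom: raising the disk from height `h i` to the parabola moves it away from
  -- the obstacle.
  · obtain ⟨i, hbi, hhi, hhxi, hni, hCi, hCxi⟩ := ((hb.eventually_lt_const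
      (show -r < 0 by linarith)).and (hh0.and (hhx.and (hnear.and (hC.and hCx))))).exists
    have := hCxi _ _ hCi
    nlinarith

/-! ### Compactness and orthonormal coordinates -/

theorem inset_subset {X : Set Plane} {s : ℝ} (hs : 0 ≤ s) : inset X s ⊆ X := by
  intro x hx
  by_contra h
  have := mem_inset.1 hx x h
  simp at this
  linarith

theorem isCompact_offset {X : Set Plane} (hX : IsCompact X) (s : ℝ) : IsCompact (offset X s) :=
  hX.add (isCompact_closedBall _ _)

theorem isCompact_inset {X : Set Plane} (hX : IsCompact X) {s : ℝ} (hs : 0 ≤ s) :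
    IsCompact (inset X s) :=
  hX.of_isClosed_subset (isClosed_compl_iff.2 hX.isClosed.isOpen_compl.add_right)
    (inset_subset hs)

theorem eq_inner_smul_add_inner_smul {e u : Plane} (he : ‖e‖ = 1) (hu : ‖u‖ = 1)
    (heu : inner ℝ e u = 0) (v : Plane) : v = inner ℝ e v • e + inner ℝ u v • u := by
  have hon : Orthonormal ℝ ![e, u] := by
    simp [orthonormal_vecCons_iff, he, hu, heu]
  let b := basisOfOrthonormalOfCardEqFinrank hon (by simp)
  have hb : ⇑b = ![e, u] := coe_basisOfOrthonormalOfCardEqFinrank hon (by simp)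
  have h := (b.toOrthonormalBasis (by rwa [hb])).sum_repr' v
  simpa [hb] using h.symm

theorem norm_smul_add_smul_sq {e u : Plane} (he : ‖e‖ = 1) (hu : ‖u‖ = 1)
    (heu : inner ℝ e u = 0) (a b : ℝ) : ‖a • e + b • u‖ ^ 2 = a ^ 2 + b ^ 2 := by
  rw [norm_add_sq_real, norm_smul, norm_smul, inner_smul_left, inner_smul_right, heu, he, hu]
  simp

/-! ### Nearest centers at a tight point -/

/-- If `q` is at maximal distance `r + ε` from the centers, and `Q` leaves `q` in the direction
`e`, then some nearest center makes an acute angle with `e`. -/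
theorem exists_center_inner_neg {Q : Set Plane} (hQ : IsCompact Q)
    (hcone : ∀ k ∈ Q, ∃ ρ > 0, IsConeWithin Q k ρ) {r ε : ℝ} (hr : 0 < r) (hε : 0 < ε)
    (hcov : Q ⊆ offset (inset (offset Q ε) r) (r + ε)) {q e : Plane} (he : ‖e‖ = 1)
    {ρ : ℝ} (hρ : 0 < ρ) (hseg : ∀ s, 0 ≤ s → s < ρ → q + s • e ∈ Q)
    (htight : ∀ p ∈ inset (offset Q ε) r, r + ε ≤ ‖q - p‖) :
    ∃ p ∈ inset (offset Q ε) r, inner ℝ e (q - p) < 0 ∧ ‖q - p‖ ≤ r + ε := by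
  by_contra! hcon
  have hR : 0 < r + ε := by linarith
  have hJ : IsCompact (inset (offset Q ε) r) := isCompact_inset (isCompact_offset hQ ε) hr.le
  -- Along an ultrafilter both the centers and the blocking points converge, without extracting
  -- subsequences.
  set l : Ultrafilter ℝ := Ultrafilter.of (𝓝[>] (0 : ℝ)) with hl_def
  have hl : (l : Filter ℝ) ≤ 𝓝[>] 0 := Ultrafilter.of_le _
  have hl0 : Tendsto (fun s : ℝ => s) l (𝓝 0) := hl.trans nhdsWithin_le_nhds
  have hs0 : ∀ᶠ s in (l : Filter ℝ), 0 < s := hl self_mem_nhdsWithin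
  have hsρ : ∀ᶠ s in (l : Filter ℝ), s < ρ := hl0.eventually_lt_const hρ
  have hP : ∀ s, 0 < s → s < ρ → ∃ p ∈ inset (offset Q ε) r, ‖q + s • e - p‖ ≤ r + ε :=
    fun s h0 h1 => mem_offset.1 (hcov (hseg s h0.le h1))
  choose! P hPJ hPd using hP
  obtain ⟨p, hp, hPp⟩ : ∃ p ∈ inset (offset Q ε) r, Tendsto P l (𝓝 p) :=
    hJ.ultrafilter_le_nhds' (l.map P) (show ∀ᶠ s in (l : Filter ℝ), P s ∈ _ by
      filter_upwards [hs0, hsρ] with s h0 h1 using hPJ s h0 h1)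
  have hqp : ‖q - p‖ = r + ε := by
    refine le_antisymm ?_ (htight p hp)
    have : Tendsto (fun s => ‖q + s • e - P s‖) l (𝓝 ‖q + (0 : ℝ) • e - p‖) :=
      ((tendsto_const_nhds.add (hl0.smul_const e)).sub hPp).norm
    rw [zero_smul, add_zero] at this
    exact le_of_tendsto this (by filter_upwards [hs0, hsρ] with s h0 h1 using hPd s h0 h1)
  have hadv : ∀ᶠ s in (l : Filter ℝ), inner ℝ e (q - P s) ≤ - (s / 2) := by
    filter_upwards [hs0, hsρ] with s h0 h1
    have h2 := pow_le_pow_left₀ (norm_nonneg _) (hPd s h0 h1) 2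
    have h3 := pow_le_pow_left₀ hR.le (htight _ (hPJ s h0 h1)) 2
    rw [show q + s • e - P s = s • e + (q - P s) by abel, norm_add_sq_real, norm_smul, he,
      inner_smul_left, Real.norm_of_nonneg h0.le] at h2
    simp only [conj_trivial, mul_one] at h2
    have h4 : s * (2 * inner ℝ e (q - P s) + s) ≤ 0 := by linarith
    linarith [nonpos_of_mul_nonpos_right h4 h0]
  have hperp : inner ℝ e (q - p) = 0 := by
    refine le_antisymm ?_ ?_
    · have : Tendsto (fun s => inner ℝ e (q - P s)) l (𝓝 (inner ℝ e (q - p))) :=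
        tendsto_const_nhds.inner (tendsto_const_nhds.sub hPp)
      refine le_of_tendsto this ?_
      filter_upwards [hs0, hadv] with s h0 h1
      linarith
    · by_contra! h
      exact absurd (hcon p hp h) (not_lt.2 hqp.le)
  obtain ⟨u, hu⟩ : ∃ u : Plane, q - p = (r + ε) • u :=
    ⟨(r + ε)⁻¹ • (q - p), by rw [smul_smul, mul_inv_cancel₀ hR.ne', one_smul]⟩
  have hu1 : ‖u‖ = 1 := by
    rw [hu, norm_smul, Real.norm_of_nonneg hR.le] at hqp
    exact mul_left_cancel₀ hR.ne' (by linarith)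
  have heu : inner ℝ e u = 0 := by
    rw [hu, inner_smul_right] at hperp
    exact (mul_eq_zero.1 hperp).resolve_left hR.ne'
  let pt : ℝ → ℝ → Plane := fun a b => p + a • e + b • u
  have hpt : ∀ v : Plane, v = pt (inner ℝ e (v - p)) (inner ℝ u (v - p)) := fun v => by
    simp only [pt, add_assoc, ← eq_inner_smul_add_inner_smul he hu1 heu]
    abel
  have hdist : ∀ a b a' b' : ℝ, ‖pt a b - pt a' b'‖ ^ 2 = (a - a') ^ 2 + (b - b') ^ 2 := by
    intro a b a' b'
    rw [← norm_smul_add_smul_sq he hu1 heu]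
    congr 2
    simp only [pt]
    module
  have hqpt : q = pt 0 (r + ε) := by
    simp only [pt, zero_smul, add_zero, ← hu]
    abel
  have hppt : p = pt 0 0 := by simp [pt]
  have hspt : ∀ s : ℝ, q + s • e = pt s (r + ε) := by
    intro s
    simp only [pt]
    rw [add_right_comm, ← hu]
    abel
  have hin : ∀ w : Plane, Tendsto (fun s => inner ℝ w (P s - p)) l (𝓝 0) := by
    intro w
    have : Tendsto (fun s => inner ℝ w (P s - p)) l (𝓝 (inner ℝ w (p - p))) :=
      tendsto_const_nhds.inner (hPp.sub tendsto_const_nhds)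
    simpa using this
  set x : ℝ → ℝ := fun s => inner ℝ e (P s - p) with hx_def
  set h : ℝ → ℝ := fun s => inner ℝ u (P s - p) with hh_def
  have hx : Tendsto x l (𝓝 0) := hin e
  have hh : Tendsto h l (𝓝 0) := hin u
  have hPpt : ∀ s, P s = pt (x s) (h s) := fun s => hpt (P s)
  have hx0 : ∀ᶠ s in (l : Filter ℝ), 0 < x s := by
    filter_upwards [hs0, hadv] with s h0 h1
    have : inner ℝ e (q - P s) = - x s := by
      rw [show q - P s = (q - p) - (P s - p) by abel, inner_sub_right, hperp, zero_sub]
    linarith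
  have hh0 : ∀ᶠ s in (l : Filter ℝ), 0 ≤ h s := by
    filter_upwards [hs0, hsρ] with s h0 h1
    have h2 := pow_le_pow_left₀ (norm_nonneg _) (hPd s h0 h1) 2
    rw [hspt, hPpt, hdist] at h2
    nlinarith [sq_nonneg (s - x s)]
  have hhx : ∀ᶠ s in (l : Filter ℝ), h s ≤ x s ^ 2 / (2 * r) := by
    filter_upwards [hs0, hsρ, hh0, hh.eventually_lt_const hε] with s h0 h1 h2 h3
    have h4 := pow_le_pow_left₀ hR.le (htight _ (hPJ s h0 h1)) 2
    rw [hqpt, hPpt, hdist] at h4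
    rw [le_div_iff₀ (by positivity)]
    nlinarith
  have hx2 : Tendsto (fun s => x s ^ 2) l (𝓝 0) := by simpa using hx.pow 2
  -- The height `x² / (2r)` puts the point strictly within `r + ε` of `q`, yet outside the open
  -- `r`-disk around `(0, r)`.
  have hblock : ∀ᶠ s in (l : Filter ℝ), ∃ c, c ∉ offset Q ε ∧
      ‖c - pt (x s) (x s ^ 2 / (2 * r))‖ ≤ r := by
    filter_upwards [hx0, hx2.eventually_lt_const (show 0 < 4 * r * ε by positivity)] with s h0 h1
    by_contra! hno
    have h2 := pow_le_pow_left₀ hR.le (htight _ (mem_inset.2 hno)) 2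
    rw [hqpt, hdist] at h2
    have h3 : (0 - x s) ^ 2 + (r + ε - x s ^ 2 / (2 * r)) ^ 2 = (r + ε) ^ 2
        - x s ^ 2 * (4 * r * ε - x s ^ 2) / (4 * r ^ 2) := by
      field_simp
      ring
    have h4 : 0 < x s ^ 2 * (4 * r * ε - x s ^ 2) / (4 * r ^ 2) :=
      div_pos (mul_pos (pow_pos h0 2) (by linarith)) (by positivity)
    linarith
  obtain ⟨c, hc⟩ : ∃ c : ℝ → Plane, ∀ᶠ s in (l : Filter ℝ), c s ∉ offset Q ε ∧
      ‖c s - pt (x s) (x s ^ 2 / (2 * r))‖ ≤ r := by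
    classical
    exact ⟨fun s => if hs : ∃ c, c ∉ offset Q ε ∧ ‖c - pt (x s) (x s ^ 2 / (2 * r))‖ ≤ r
      then hs.choose else 0, hblock.mono fun s hs => by
        simp only [dif_pos hs]; exact hs.choose_spec⟩
  have hpt' : Tendsto (fun s => pt (x s) (x s ^ 2 / (2 * r))) l (𝓝 p) := by
    have : Tendsto (fun s => pt (x s) (x s ^ 2 / (2 * r))) l
        (𝓝 (p + (0 : ℝ) • e + (0 / (2 * r)) • u)) :=
      (tendsto_const_nhds.add (hx.smul_const e)).add ((hx2.div_const (2 * r)).smul_const u)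
    simpa using this
  obtain ⟨w, -, hcw⟩ : ∃ w ∈ closedBall p (r + 1), Tendsto c l (𝓝 w) :=
    (isCompact_closedBall p (r + 1)).ultrafilter_le_nhds' (l.map c) (show ∀ᶠ s in (l : Filter ℝ), c s ∈ _ by
      filter_upwards [hc, hpt'.eventually (ball_mem_nhds p one_pos)] with s h1 h2
      rw [← dist_eq_norm] at h1
      exact (dist_triangle _ _ _).trans (add_le_add h1.2 (mem_ball.1 h2).le))
  have hcpt : ∀ s, c s = pt (inner ℝ e (c s - p)) (inner ℝ u (c s - p)) := fun s => hpt (c s)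
  obtain ⟨σ, hσ, hstar⟩ := exists_dilation_notMem_offset hQ hcone ε (pt 0 r)
  refine false_of_blocked (l := (l : Filter ℝ)) (C := fun a b => pt a b ∉ offset Q ε)
    hr hε hρ hσ hx hh
    (tendsto_const_nhds.inner (hcw.sub tendsto_const_nhds))
    (tendsto_const_nhds.inner (hcw.sub tendsto_const_nhds)) hx0 hh0 hhx
    (a := fun s => inner ℝ e (c s - p)) (b := fun s => inner ℝ u (c s - p))
    ?_ ?_ ?_ ?_ ?_ ?_
  · filter_upwards [hc] with s hs
    rw [← hcpt]
    exact hs.1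
  · intro a b hab
    have := pow_lt_pow_left₀ (mem_inset.1 hp _ hab) hr.le two_ne_zero
    rw [hppt, ← hppt, hppt, hdist] at this
    simpa using this
  · filter_upwards [hs0, hsρ] with s h0 h1 a b hab
    have := pow_lt_pow_left₀ (mem_inset.1 (hPJ s h0 h1) _ hab) hr.le two_ne_zero
    rwa [hPpt, hdist] at this
  · intro a b hab s h0 h1
    by_contra! hle
    refine hab (mem_offset.2 ⟨_, hseg s h0 h1, ?_⟩)
    rw [hspt]
    refine le_of_sq_le_sq ?_ hε.le
    rwa [hdist]
  · intro a b t ht0 ht1 hab hC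
    have h1 : ∀ t : ℝ, pt 0 r + t • (a • e + b • u) = pt (t * a) (r + t * b) := by
      intro t
      simp only [pt]
      module
    have h2 := hstar (a • e + b • u) (lt_of_pow_lt_pow_left₀ 2 hσ.le (by
      rwa [norm_smul_add_smul_sq he hu1 heu])) t ht0 ht1 (by rwa [h1])
    have h3 := h1 1
    rw [one_smul, one_mul, one_mul] at h3
    rwa [h3] at h2
  · filter_upwards [hc] with s hs
    have := pow_le_pow_left₀ (norm_nonneg _) hs.2 2
    rw [hcpt s, hdist] at this
    exact this

/-! ### Reduction to finitely many centers -/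

theorem Set.Finite.isPolygonalRegion {F : Set Plane} (hF : F.Finite) : IsPolygonalRegion F := by
  classical
  refine ⟨hF.isClosed, hF.toFinset.image fun p => (p, p), ?_, ?_⟩
  · have : interior F = ∅ :=
      interior_eq_empty_iff_dense_compl.2 (hF.countable.dense_compl ℝ)
    rw [hF.isClosed.frontier_eq, this]
    ext y
    simp
  · intro e he f hf hef
    simp only [Finset.coe_image, Set.mem_image, Set.Finite.coe_toFinset] at he hf
    obtain ⟨a, -, rfl⟩ := he
    obtain ⟨b, -, rfl⟩ := hf
    have hab : a ≠ b := fun h => hef (by rw [h])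
    simpa [Function.onFun] using hab

/-- The centers which cover `Q` can be reduced to finitely many ones. -/
theorem exists_finite_subset_offset {Q : Set Plane} (hQ : IsCompact Q)
    (hcone : ∀ k ∈ Q, ∃ ρ > 0, IsConeWithin Q k ρ) {r ε : ℝ} (hr : 0 < r) (hε : 0 < ε)
    (hcov : Q ⊆ offset (inset (offset Q ε) r) (r + ε)) :
    ∃ F ⊆ inset (offset Q ε) r, F.Finite ∧ Q ⊆ offset F (r + ε) := by
  set J := inset (offset Q ε) r with hJ
  have hmono : ∀ {F G : Set Plane}, F ⊆ G → offset F (r + ε) ⊆ offset G (r + ε) :=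
    fun h => Set.add_subset_add_right h
  refine hQ.induction_on (p := fun A => ∃ F ⊆ J, F.Finite ∧ A ⊆ offset F (r + ε))
    ⟨∅, by simp⟩ (fun A B hAB ⟨F, h1, h2, h3⟩ => ⟨F, h1, h2, hAB.trans h3⟩) ?_ ?_
  · rintro A B ⟨F, h1, h2, h3⟩ ⟨G, h4, h5, h6⟩
    exact ⟨F ∪ G, Set.union_subset h1 h4, h2.union h5, Set.union_subset
      (h3.trans (hmono Set.subset_union_left)) (h6.trans (hmono Set.subset_union_right))⟩
  intro q hq
  obtain ⟨p₀, hp₀, hqp₀⟩ := mem_offset.1 (hcov hq)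
  by_cases htight : ∀ p ∈ J, r + ε ≤ ‖q - p‖
  swap
  · push Not at htight
    obtain ⟨p, hp, hlt⟩ := htight
    refine ⟨ball p (r + ε), mem_nhdsWithin_of_mem_nhds (isOpen_ball.mem_nhds (by
      rwa [mem_ball, dist_eq_norm])), {p}, by simpa, Set.finite_singleton p, fun y hy => ?_⟩
    rw [mem_ball, dist_eq_norm] at hy
    exact mem_offset.2 ⟨p, rfl, hy.le⟩
  obtain ⟨ρ, hρ, hcq⟩ := hcone q hq
  let E : Set Plane := {e | ‖e‖ = 1 ∧ q + (ρ / 2) • e ∈ Q}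
  have hE : IsCompact E := by
    have : E = sphere 0 1 ∩ (fun e => q + (ρ / 2) • e) ⁻¹' Q := by ext; simp [E]
    rw [this]
    exact (isCompact_sphere _ _).inter_right (hQ.isClosed.preimage (by fun_prop))
  have hdir : ∃ δ > 0, ∃ F ⊆ J, F.Finite ∧ ∀ e ∈ E, ∀ s : ℝ, 0 < s → s < δ →
      q + s • e ∈ offset F (r + ε) := by
    refine hE.induction_on (p := fun A => ∃ δ > 0, ∃ F ⊆ J, F.Finite ∧ ∀ e ∈ A, ∀ s : ℝ,
      0 < s → s < δ → q + s • e ∈ offset F (r + ε)) ⟨1, one_pos, ∅, by simp⟩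
      (fun A B hAB ⟨δ, h0, F, h1, h2, h3⟩ => ⟨δ, h0, F, h1, h2, fun e he => h3 e (hAB he)⟩) ?_ ?_
    · rintro A B ⟨δ, h0, F, h1, h2, h3⟩ ⟨δ', h0', G, h4, h5, h6⟩
      refine ⟨min δ δ', lt_min h0 h0', F ∪ G, Set.union_subset h1 h4, h2.union h5, ?_⟩
      rintro e (he | he) s hs hsδ
      · exact hmono Set.subset_union_left (h3 e he s hs (lt_min_iff.1 hsδ).1)
      · exact hmono Set.subset_union_right (h6 e he s hs (lt_min_iff.1 hsδ).2)
    rintro e ⟨he, heQ⟩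
    have hray : ∀ s : ℝ, 0 ≤ s → s < ρ → q + s • e ∈ Q := by
      intro s hs hsρ
      rcases hs.eq_or_lt with rfl | hs
      · simpa
      have hmul : (s / (ρ / 2)) • (ρ / 2) • e = s • e := by
        rw [smul_smul, div_mul_cancel₀ _ (by positivity)]
      have := hcq ((ρ / 2) • e) (by
        rw [norm_smul, he, Real.norm_of_nonneg (by positivity)]; linarith) heQ (s / (ρ / 2))
        (by positivity) (by rwa [hmul, norm_smul, he, Real.norm_of_nonneg hs.le, mul_one])
      rwa [hmul] at this
    obtain ⟨p, hp, hneg, hle⟩ := exists_center_inner_neg hQ hcone hr hε hcov he hρ hray htight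
    -- Halving leaves a margin for nearby directions; `η` also bounds the length of ray covered.
    set η := - inner ℝ e (q - p) / 2 with hη
    have hη0 : 0 < η := by rw [hη]; linarith
    refine ⟨{e' | ‖e'‖ = 1 ∧ inner ℝ e' (q - p) < -η}, ?_, η, hη0, {p}, by simpa,
      Set.finite_singleton p, ?_⟩
    · have hopen : IsOpen {e' : Plane | inner ℝ e' (q - p) < -η} :=
        isOpen_lt (by fun_prop) continuous_const
      filter_upwards [self_mem_nhdsWithin, mem_nhdsWithin_of_mem_nhds (hopen.mem_nhds
        (show inner ℝ e (q - p) < -η by rw [hη]; linarith))] with e' h1 h2 using ⟨h1.1, h2⟩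
    · rintro e' ⟨he', hlt⟩ s hs hsη
      refine mem_offset.2 ⟨p, rfl, le_of_sq_le_sq ?_ (by linarith)⟩
      rw [show q + s • e' - p = s • e' + (q - p) by abel, norm_add_sq_real, norm_smul, he',
        inner_smul_left, Real.norm_of_nonneg hs.le]
      simp only [conj_trivial, mul_one]
      have := pow_le_pow_left₀ (norm_nonneg _) hle 2
      nlinarith
  obtain ⟨δ, hδ, F, hFJ, hF, hFE⟩ := hdir
  refine ⟨Q ∩ ball q (min δ ρ), inter_mem_nhdsWithin _ (ball_mem_nhds q (lt_min hδ hρ)),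
    insert p₀ F, Set.insert_subset hp₀ hFJ, hF.insert p₀, ?_⟩
  rintro y ⟨hyQ, hyb⟩
  rcases eq_or_ne y q with rfl | hyq
  · exact mem_offset.2 ⟨p₀, Set.mem_insert _ _, hqp₀⟩
  rw [mem_ball, dist_eq_norm] at hyb
  obtain ⟨hyδ, hyρ⟩ := lt_min_iff.1 hyb
  have hn : 0 < ‖y - q‖ := norm_pos_iff.2 (sub_ne_zero.2 hyq)
  have hy : y = q + ‖y - q‖ • ‖y - q‖⁻¹ • (y - q) := by
    rw [smul_smul, mul_inv_cancel₀ hn.ne', one_smul]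
    abel
  have hnorm : ‖‖y - q‖⁻¹ • (y - q)‖ = 1 := by
    rw [norm_smul, norm_inv, norm_norm, inv_mul_cancel₀ hn.ne']
  rw [hy]
  refine hmono (Set.subset_insert _ _) (hFE _ ⟨hnorm, ?_⟩ _ hn hyδ)
  rw [smul_smul]
  refine hcq (y - q) hyρ (by simpa) _ (by positivity) ?_
  rw [← smul_smul, norm_smul, hnorm, Real.norm_of_nonneg (by positivity)]
  linarith

/-! ### Hausdorff distance through offsets, and the equivalence -/

theorem offset_eq_cthickening {X : Set Plane} (hX : IsClosed X) {s : ℝ} (hs : 0 ≤ s) :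
    offset X s = cthickening s X := by
  rw [hX.cthickening_eq_biUnion_closedBall hs]
  ext x
  simp [mem_offset, dist_eq_norm]

theorem isClose_iff {X Y : Set Plane} {s : ℝ} (hX : IsClosed X) (hY : IsClosed Y) (hs : 0 ≤ s) :
    IsClose s X Y ↔ X ⊆ offset Y s ∧ Y ⊆ offset X s := by
  rw [offset_eq_cthickening hX hs, offset_eq_cthickening hY hs, IsClose,
    hausdorffEDist_def, sup_le_iff]
  simp [Set.subset_def, mem_cthickening_iff]

theorem decide_eq_YES_iff {Q : Set Plane} {r ε : ℝ} :
    Decide Q r ε = Answer.YES ↔ Q ⊆ offset (inset (offset Q ε) r) (r + ε) := by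
  simp [Decide]

theorem offset_offset {X : Set Plane} (hX : IsClosed X) {s t : ℝ} (hs : 0 ≤ s) (ht : 0 ≤ t) :
    offset (offset X s) t = offset X (s + t) := by
  rw [offset_eq_cthickening hX hs, offset_eq_cthickening isClosed_cthickening ht,
    cthickening_cthickening ht hs, offset_eq_cthickening hX (add_nonneg hs ht), add_comm]

theorem offset_inset_subset (X : Set Plane) (s : ℝ) : offset (inset X s) s ⊆ X := by
  intro x hx
  obtain ⟨y, hy, hxy⟩ := mem_offset.1 hx
  by_contra h
  exact absurd (mem_inset.1 hy x h) (not_lt.2 hxy)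

theorem subset_inset_of_offset_subset {X Y : Set Plane} {s : ℝ} (h : offset X s ⊆ Y) :
    X ⊆ inset Y s := by
  intro x hx
  refine mem_inset.2 fun c hc => ?_
  by_contra! hle
  exact hc (h (mem_offset.2 ⟨x, hx, hle⟩))

theorem mainTheorem2 (Q : Set Plane) (hQ : IsPolygonalRegion Q) (hQb : Bornology.IsBounded Q)
    (r ε : ℝ) (hr : 0 < r) (hε : 0 < ε) :
    Decide Q r ε = Answer.YES ↔
      ∃ P : Set Plane, IsPolygonalRegion P ∧ IsClose ε (offset P r) Q := by
  have hQc : IsCompact Q := isCompact_of_isClosed_isBounded hQ.1 hQb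
  rw [decide_eq_YES_iff]
  have hclosed : ∀ P : Set Plane, IsPolygonalRegion P → IsClosed (offset P r) := fun P hP => by
    rw [offset_eq_cthickening hP.1 hr.le]
    exact isClosed_cthickening
  constructor
  · intro h
    obtain ⟨F, hFJ, hF, hQF⟩ :=
      exists_finite_subset_offset hQc (fun _ _ => hQ.exists_isConeWithin) hr hε h
    refine ⟨F, hF.isPolygonalRegion,
      (isClose_iff (hclosed F hF.isPolygonalRegion) hQ.1 hε.le).2 ⟨?_, ?_⟩⟩
    · exact (Set.add_subset_add_right hFJ).trans (offset_inset_subset _ _)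
    · rwa [offset_offset hF.isClosed hr.le hε.le]
  · rintro ⟨P, hP, hPQ⟩
    obtain ⟨h1, h2⟩ := (isClose_iff (hclosed P hP) hQ.1 hε.le).1 hPQ
    rw [offset_offset hP.1 hr.le hε.le] at h2
    exact h2.trans (Set.add_subset_add_right (subset_inset_of_offset_subset h1))
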